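/- For a binary word $w$ let $\overline{w}$ denote its complement, obtained by exchanging $0$ and $1$. Define finite words by $R_0 = 0$, $R_1 = 00$, and, for $n \ge 2$, $$R_n = \begin{cases} R_{n-1} R_{n-2}, & \text{if } n \equiv 0 \pmod 3; \\ R_{n-1} \overline{R_{n-2}}, & \text{if } n \equiv 1, 2 \pmod 3. \end{cases}$$ Each $R_n$ is a prefix of $R_{n+1}$; the Rote-Fibonacci word ${\bf r} = 001001101101100100110\cdots$ is the infinite binary word that has every $R_n$ as a prefix. A square is a nonempty word of the form $xx$, and its order is $|x|$. The Fibonacci numbers are $F_0 = 0$, $F_1 = 1$, and $F_n = F_{n-1} + F_{n-2}$ for $n \ge 2$. Theorem. Every square that occurs as a factor of ${\bf r}$ has order $F_{3n+1}$ for some integer $n \ge 0$. Conversely, for every integer $n \ge 0$, a square of order $F_{3n+1}$ occurs as a factor of ${\bf r}$. -/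

import Mathlib

/-- The complement of a binary word: every `0` becomes `1` and every `1` becomes `0`. -/
def complementWord (w : List (Fin 2)) : List (Fin 2) :=
  w.map fun a => 1 - a

/-- The finite Rote-Fibonacci words: `R₀ = 0`, `R₁ = 00`, and for `n ≥ 2`,
`Rₙ = Rₙ₋₁ Rₙ₋₂` if `n ≡ 0 (mod 3)`, while `Rₙ` is `Rₙ₋₁` followed by the complement of `Rₙ₋₂`
otherwise. -/
def finiteRoteFibonacci : ℕ → List (Fin 2)
  | 0 => [0]
  | 1 => [0, 0]
  | n + 2 =>
    if (n + 2) % 3 = 0 then finiteRoteFibonacci (n + 1) ++ finiteRoteFibonacci n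
    else finiteRoteFibonacci (n + 1) ++ complementWord (finiteRoteFibonacci n)

/-- The Rote-Fibonacci word `r₀ r₁ r₂ ⋯ = 001001101101100 ⋯`, the limit of the finite words `Rₙ`.
The word `Rᵢ` has more than `i` letters, so the default value is never used; that every `Rₙ` is a
prefix of the infinite word is proved below. -/
def roteFibonacci (i : ℕ) : Fin 2 :=
  (finiteRoteFibonacci i).getD i 0

/-- The finite word `w` is a factor of (occurs in) the infinite word `s`. -/
def OccursIn {α : Type*} (w : List α) (s : ℕ → α) : Prop :=
  ∃ i : ℕ, ∀ (j : ℕ) (hj : j < w.length), w[j] = s (i + j)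

/-- `w` is a square of order `n`: a nonempty word of the form `x x` with `|x| = n`. -/
def IsSquareOfOrder {α : Type*} (w : List α) (n : ℕ) : Prop :=
  w ≠ [] ∧ ∃ x : List α, w = x ++ x ∧ x.length = n

theorem finiteRoteFibonacci_length (n : ℕ) :
    (finiteRoteFibonacci n).length = Nat.fib (n + 2) := by
  induction n using Nat.twoStepInduction with
  | zero => rfl
  | one => rfl
  | more n h1 h2 =>
    rw [finiteRoteFibonacci, Nat.fib_add_two (n := n + 2)]
    split_ifs <;> (simp [complementWord, h1, h2]; exact Nat.add_comm _ _)

theorem lt_finiteRoteFibonacci_length (n : ℕ) : n < (finiteRoteFibonacci n).length := by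
  rw [finiteRoteFibonacci_length]
  induction n with
  | zero => simp
  | succ k ih =>
    have h1 : 0 < Nat.fib (k + 1) := Nat.fib_pos.2 (Nat.succ_pos k)
    have h2 : Nat.fib (k + 1 + 2) = Nat.fib (k + 1) + Nat.fib (k + 2) := Nat.fib_add_two
    omega

theorem finiteRoteFibonacci_prefix {m n : ℕ} (h : m ≤ n) :
    finiteRoteFibonacci m <+: finiteRoteFibonacci n := by
  induction n, h using Nat.le_induction with
  | base => exact List.prefix_rfl
  | succ k _ ih =>
    refine ih.trans ?_
    cases k with
    | zero => exact ⟨[0], rfl⟩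
    | succ k =>
      rw [finiteRoteFibonacci.eq_3]
      split_ifs <;> exact List.prefix_append _ _

/-- The infinite word is the limit of the finite words: each `Rₙ` is a prefix of it. -/
theorem roteFibonacci_eq_getElem (n i : ℕ) (hi : i < (finiteRoteFibonacci n).length) :
    roteFibonacci i = (finiteRoteFibonacci n)[i] := by
  have hi' := lt_finiteRoteFibonacci_length i
  rw [roteFibonacci, List.getD_eq_getElem _ _ hi']
  rcases le_total i n with h | h
  · exact (finiteRoteFibonacci_prefix h).getElem hi'
  · exact ((finiteRoteFibonacci_prefix h).getElem hi).symm

/-! Write `b = -ψ = 1/φ`. The word is a rotation coding: its letter at `i` is the parity of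
`⌊b(i+2)⌋` (`roteFibonacci_eq_zero_iff`). A square of order `m` thus makes `⌊b(j+m)⌋ - ⌊bj⌋` even
for `m` consecutive `j`. This difference is `⌊bm⌋` or `⌊bm⌋ + 1`, and both occur in the window
unless `bm` is very close to an integer, which must then be even (`exists_even_abs_lt`). Such
closeness forces `m = F_{k+2}` with nearest integer `F_{k+1}` (`eq_fib_of_abs_lt`), and `F_{k+1}` is
even only when `3 ∣ k+1`. The converse follows from the recursion. -/

theorem even_fib_iff (n : ℕ) : Even (Nat.fib n) ↔ n % 3 = 0 := by
  have h : Nat.fib n % 2 = (if n % 3 = 0 then 0 else 1) ∧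
      Nat.fib (n + 1) % 2 = (if (n + 1) % 3 = 0 then 0 else 1) := by
    induction n with
    | zero => decide
    | succ n ih =>
      have := Nat.fib_add_two (n := n)
      refine ⟨ih.2, ?_⟩
      rw [show n + 1 + 1 = n + 2 from rfl]
      split_ifs at * <;> omega
  rw [Nat.even_iff, h.1]
  split_ifs with h3 <;> simp [h3]

/-- `Rₙ₊₂` is `Rₙ₊₁` followed by `Rₙ` or by its complement. -/
theorem roteFibonacci_fib_add {n i : ℕ} (hi : i < Nat.fib (n + 2)) :
    roteFibonacci (Nat.fib (n + 3) + i) =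
      if (n + 2) % 3 = 0 then roteFibonacci i else 1 - roteFibonacci i := by
  have hl : (finiteRoteFibonacci (n + 1)).length = Nat.fib (n + 3) :=
    finiteRoteFibonacci_length (n + 1)
  have hi' : i < (finiteRoteFibonacci n).length := by rwa [finiteRoteFibonacci_length]
  have hlt : Nat.fib (n + 3) + i < (finiteRoteFibonacci (n + 2)).length := by
    rw [finiteRoteFibonacci_length, Nat.fib_add_two (n := n + 2)]
    rw [show n + 2 + 1 = n + 3 from rfl]
    omega
  rw [roteFibonacci_eq_getElem _ _ hlt, roteFibonacci_eq_getElem n i hi']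
  simp only [finiteRoteFibonacci]
  split_ifs
  · rw [List.getElem_append_right (by omega)]
    simp [hl]
  · rw [List.getElem_append_right (by omega)]
    simp [hl, complementWord]

/-! ### Rational approximation of `-ψ` -/

theorem one_add_neg_goldenConj_mul : (1 + -Real.goldenConj) * -Real.goldenConj = 1 := by
  linear_combination Real.goldenConj_sq

/-- Consecutive pairs of Fibonacci numbers form a basis of `ℤ²`. -/
theorem exists_fib_coordinates (k : ℕ) (j p : ℤ) :
    ∃ x y : ℤ, j = x * Nat.fib (k + 2) + y * Nat.fib (k + 1) ∧
      p = x * Nat.fib (k + 1) + y * Nat.fib k := by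
  induction k with
  | zero => exact ⟨p, j - p, by simp, by simp⟩
  | succ k ih =>
    obtain ⟨x, y, hj, hp⟩ := ih
    refine ⟨y, x - y, ?_, ?_⟩
    · have := Nat.fib_add_two (n := k + 1)
      rw [show k + 1 + 2 = k + 3 from rfl, show k + 1 + 1 = k + 2 from rfl] at *
      rw [this, hj]; push_cast; ring
    · have := Nat.fib_add_two (n := k)
      rw [show k + 1 + 1 = k + 2 from rfl]
      rw [this, hp]; push_cast; ring

theorem goldenConj_mul_add_of_fib_coordinates {k : ℕ} {j p x y : ℤ}
    (hj : j = x * Nat.fib (k + 2) + y * Nat.fib (k + 1))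
    (hp : p = x * Nat.fib (k + 1) + y * Nat.fib k) :
    Real.goldenConj * j + p = Real.goldenConj ^ (k + 1) * (x * Real.goldenConj + y) := by
  have h1 := Real.goldenConj_mul_fib_succ_add_fib k
  have h2 := Real.goldenConj_mul_fib_succ_add_fib (k + 1)
  rw [show k + 1 + 1 = k + 2 from rfl] at h2
  rw [hj, hp]; push_cast
  linear_combination (x : ℝ) * h2 + (y : ℝ) * h1

theorem abs_goldenConj_pow (k : ℕ) : |Real.goldenConj ^ k| = (-Real.goldenConj) ^ k := by
  rw [abs_pow, abs_of_neg Real.goldenConj_neg]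

/-- The denominators `fib k` are best approximations to `-ψ`. -/
theorem le_abs_goldenConj_mul_add {k : ℕ} {j : ℤ} (h0 : 0 < j) (hj : j < Nat.fib (k + 2))
    (p : ℤ) : (-Real.goldenConj) ^ (k + 1) ≤ |Real.goldenConj * j + p| := by
  obtain ⟨x, y, hx, hy⟩ := exists_fib_coordinates k j p
  rw [goldenConj_mul_add_of_fib_coordinates hx hy, abs_mul, abs_goldenConj_pow]
  have hψ := Real.goldenConj_neg
  have hF1 : (0 : ℤ) < Nat.fib (k + 1) := by exact_mod_cast Nat.fib_pos.2 (by omega)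
  have hF2 : (0 : ℤ) < Nat.fib (k + 2) := by exact_mod_cast Nat.fib_pos.2 (by omega)
  refine le_mul_of_one_le_right (pow_nonneg (by linarith) _) ?_
  -- The bounds on `j` exclude `y = 0` and keep `x`, `y` from having the same sign; as `ψ < 0`, the
  -- terms `xψ` and `y` then reinforce each other.
  rcases lt_trichotomy y 0 with hy0 | hy0 | hy0
  · have hx0 : 0 < x := by
      by_contra! h
      nlinarith
    have h1 : (y : ℝ) ≤ -1 := by exact_mod_cast (by omega : y ≤ -1)
    have h2 : (0 : ℝ) < x := by exact_mod_cast hx0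
    rw [le_abs]; right; nlinarith
  · subst hy0
    have : 0 < x := by
      by_contra! h
      nlinarith
    nlinarith
  · have hx0 : x ≤ 0 := by
      by_contra! h
      nlinarith
    have h1 : (1 : ℝ) ≤ y := by exact_mod_cast hy0
    have h2 : (x : ℝ) ≤ 0 := by exact_mod_cast hx0
    rw [le_abs]; left; nlinarith

/-! ### Coding by a rotation -/

theorem floor_add_eq_of_forall_lt_abs {x ε : ℝ} (h : ∀ p : ℤ, |ε| < |x - p|) :
    ⌊x + ε⌋ = ⌊x⌋ := by
  have h0 := h ⌊x⌋
  have h1 := h (⌊x⌋ + 1)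
  have hl := Int.floor_le x
  have hu := Int.lt_floor_add_one x
  push_cast at h1
  rw [abs_of_nonneg (a := x - ⌊x⌋) (by linarith)] at h0
  rw [abs_sub_comm, abs_of_nonneg (a := ⌊x⌋ + 1 - x) (by linarith)] at h1
  rw [abs_lt] at h0 h1
  rw [Int.floor_eq_iff]
  constructor <;> linarith

/-- The shift moves `bj` by `F_{n+2}` up to an error `ψ^(n+3)`, smaller than the distance from `bj`
to any integer. -/
theorem floor_neg_goldenConj_mul_fib_add {n j : ℕ} (h0 : 0 < j) (hj : j < Nat.fib (n + 3)) :
    ⌊-Real.goldenConj * ((Nat.fib (n + 3) + j : ℕ) : ℝ)⌋ =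
      ⌊-Real.goldenConj * j⌋ + Nat.fib (n + 2) := by
  have h := Real.goldenConj_mul_fib_succ_add_fib (n + 2)
  rw [show n + 2 + 1 = n + 3 from rfl] at h
  have e : -Real.goldenConj * ((Nat.fib (n + 3) + j : ℕ) : ℝ) =
      (-Real.goldenConj * j + -Real.goldenConj ^ (n + 3)) + (Nat.fib (n + 2) : ℤ) := by
    push_cast; linear_combination -h
  rw [e, Int.floor_add_intCast, floor_add_eq_of_forall_lt_abs]
  intro p
  have hb := le_abs_goldenConj_mul_add (k := n + 1) (j := j) (by omega) (by exact_mod_cast hj) p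
  rw [abs_neg, abs_goldenConj_pow, show -Real.goldenConj * j - p = -(Real.goldenConj * j + p) by ring,
    abs_neg]
  refine lt_of_lt_of_le ?_ hb
  have hψ := Real.goldenConj_neg
  exact pow_lt_pow_right_of_lt_one₀ (by linarith) (by linarith [Real.neg_one_lt_goldenConj])
    (by omega)

theorem exists_fib_add_eq {i : ℕ} (hi : 5 ≤ i) :
    ∃ n j, 2 ≤ n ∧ j < Nat.fib (n + 2) ∧ i = Nat.fib (n + 3) + j := by
  have h5 : 5 ≤ Nat.greatestFib i := Nat.le_greatestFib.2 hi
  obtain ⟨n, hn⟩ := Nat.exists_eq_add_of_le h5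
  have h1 := Nat.fib_greatestFib_le i
  have h2 := Nat.lt_fib_greatestFib_add_one i
  rw [hn] at h1 h2
  have h3 := Nat.fib_add_two (n := n + 4)
  rw [show 5 + n = n + 5 by omega] at h1 h2
  rw [show n + 4 + 2 = n + 5 + 1 from rfl, show n + 4 + 1 = n + 5 from rfl] at h3
  exact ⟨n + 2, i - Nat.fib (n + 5), by omega, by
    rw [show n + 2 + 2 = n + 4 from rfl]; omega, by
    rw [show n + 2 + 3 = n + 5 from rfl]; omega⟩

/-- The Rote-Fibonacci word codes the parity of the multiples of `-ψ`. -/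
theorem roteFibonacci_eq_zero_iff (i : ℕ) :
    roteFibonacci i = 0 ↔ Odd ⌊-Real.goldenConj * ((i + 2 : ℕ) : ℝ)⌋ := by
  induction i using Nat.strong_induction_on with
  | _ i ih =>
    rcases lt_or_ge i 5 with hi | hi
    · have hψ := Real.goldenConj_neg
      have hs := one_add_neg_goldenConj_mul
      have hl : (3 / 5 : ℝ) < -Real.goldenConj := by nlinarith
      have hu : -Real.goldenConj < (2 / 3 : ℝ) := by nlinarith
      have key : ∀ v : ℤ, (v : ℝ) ≤ 3 / 5 * ((i + 2 : ℕ) : ℝ) →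
          2 / 3 * ((i + 2 : ℕ) : ℝ) ≤ v + 1 → ⌊-Real.goldenConj * ((i + 2 : ℕ) : ℝ)⌋ = v := by
        intro v h1 h2
        have : (0 : ℝ) < ((i + 2 : ℕ) : ℝ) := by positivity
        rw [Int.floor_eq_iff]
        constructor <;> nlinarith
      interval_cases i
      · rw [key 1 (by norm_num) (by norm_num)]; decide
      · rw [key 1 (by norm_num) (by norm_num)]; decide
      · rw [key 2 (by norm_num) (by norm_num)]; decide
      · rw [key 3 (by norm_num) (by norm_num)]; decide
      · rw [key 3 (by norm_num) (by norm_num)]; decide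
    · obtain ⟨n, j, hn, hj, rfl⟩ := exists_fib_add_eq hi
      have hF : Nat.fib (n + 3) = Nat.fib (n + 1) + Nat.fib (n + 2) := Nat.fib_add_two
      -- This keeps the shifted index `j + 2` below `F_{n+3}`, hence the base cases `i < 5`.
      have hF1 : 2 ≤ Nat.fib (n + 1) := by
        exact Nat.fib_mono (show 3 ≤ n + 1 by omega)
      rw [roteFibonacci_fib_add hj, Nat.add_assoc,
        floor_neg_goldenConj_mul_fib_add (by omega) (by omega), Int.odd_add, ← ih j (by omega),
        Int.even_coe_nat, even_fib_iff]
      generalize roteFibonacci j = a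
      split_ifs with h
      · simp [h]
      · simp only [h, iff_false]
        revert a; decide

/-! ### Existence of squares -/

/-- The word begins with a square of order `fib (3n+4)`. -/
theorem roteFibonacci_fib_add_of_lt (n i : ℕ) (hi : i < Nat.fib (3 * n + 4)) :
    roteFibonacci (Nat.fib (3 * n + 4) + i) = roteFibonacci i := by
  have h4 : Nat.fib (3 * n + 4) = Nat.fib (3 * n + 2) + Nat.fib (3 * n + 3) := Nat.fib_add_two
  have h5 : Nat.fib (3 * n + 5) = Nat.fib (3 * n + 3) + Nat.fib (3 * n + 4) := Nat.fib_add_two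
  have hle : Nat.fib (3 * n + 2) ≤ Nat.fib (3 * n + 4) := Nat.fib_mono (by omega)
  rcases lt_or_ge i (Nat.fib (3 * n + 3)) with h | h
  · have := roteFibonacci_fib_add (n := 3 * n + 1) (i := i) h
    rwa [if_pos (by omega)] at this
  · obtain ⟨j, rfl⟩ := Nat.exists_eq_add_of_le h
    -- Both positions carry the complement of the letter at `j`, since `F_{3n+4} + F_{3n+3} =
    -- F_{3n+5}`.
    have e1 := roteFibonacci_fib_add (n := 3 * n + 2) (i := j)
      (by rw [show 3 * n + 2 + 2 = 3 * n + 4 from rfl]; omega)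
    have e2 := roteFibonacci_fib_add (n := 3 * n) (i := j) (by omega)
    rw [if_neg (by omega)] at e1 e2
    rw [e2, ← e1]
    congr 1
    rw [show 3 * n + 2 + 3 = 3 * n + 5 from rfl]
    omega

/-! ### Restriction on the orders -/

/-- Among any `fib (k+2)` consecutive multiples of `-ψ`, one falls modulo 1 into a given arc of
length `(-ψ) ^ k`. -/
theorem exists_neg_goldenConj_mul_sub_mem_arc (k s : ℕ) (c : ℝ) :
    ∃ (j : ℕ) (p : ℤ), s ≤ j ∧ j < s + Nat.fib (k + 2) ∧ c ≤ -Real.goldenConj * j - p ∧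
      -Real.goldenConj * j - p < c + (-Real.goldenConj) ^ k := by
  have hψ := Real.goldenConj_neg
  induction k generalizing c with
  | zero =>
    refine ⟨s, ⌊-Real.goldenConj * s - c⌋, le_rfl, by simp, ?_, ?_⟩
    · linarith [Int.floor_le (-Real.goldenConj * s - c)]
    · rw [pow_zero]
      linarith [Int.lt_floor_add_one (-Real.goldenConj * s - c)]
  | succ k ih =>
    have hfib : Nat.fib (k + 1 + 2) = Nat.fib (k + 1) + Nat.fib (k + 2) := Nat.fib_add_two
    have hsh := Real.goldenConj_mul_fib_succ_add_fib k
    have hpow : (-Real.goldenConj) ^ k =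
        (-Real.goldenConj) ^ (k + 1) + (-Real.goldenConj) ^ (k + 2) := by
      linear_combination (-(-Real.goldenConj) ^ k) * one_add_neg_goldenConj_mul
    have hle : (-Real.goldenConj) ^ (k + 2) ≤ (-Real.goldenConj) ^ (k + 1) :=
      pow_le_pow_of_le_one (by linarith) (by linarith [Real.neg_one_lt_goldenConj]) (by omega)
    -- Adding `F_{k+1}` to `j` rotates by `b^(k+1)`, to the right for even `k` and to the left for
    -- odd `k`. A point in an arc of length `b^k` containing the target is either in the target or
    -- rotated into it.
    rcases Nat.even_or_odd k with hk | hk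
    · rw [← neg_neg (Real.goldenConj ^ (k + 1)), ← hk.add_one.neg_pow] at hsh
      obtain ⟨j, p, h1, h2, h3, h4⟩ := ih (c - (-Real.goldenConj) ^ (k + 2))
      rcases le_or_gt c (-Real.goldenConj * j - p) with h | h
      · exact ⟨j, p, h1, by omega, h, by linarith⟩
      · refine ⟨j + Nat.fib (k + 1), p + Nat.fib k, by omega, by omega, ?_, ?_⟩ <;>
          push_cast <;> linarith
    · rw [← hk.add_one.neg_pow] at hsh
      obtain ⟨j, p, h1, h2, h3, h4⟩ := ih c
      rcases lt_or_ge (-Real.goldenConj * j - p) (c + (-Real.goldenConj) ^ (k + 1)) with h | h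
      · exact ⟨j, p, h1, by omega, h3, h⟩
      · refine ⟨j + Nat.fib (k + 1), p + Nat.fib k, by omega, by omega, ?_, ?_⟩ <;>
          push_cast <;> linarith

/-- If `⌊-ψ(j+m)⌋` and `⌊-ψj⌋` agree in parity along a window, then `-ψm` is near an even
integer. -/
theorem exists_even_abs_lt {k m s : ℕ} (hm : Nat.fib (k + 2) ≤ m)
    (h : ∀ j, s ≤ j → j < s + m →
      Even (⌊-Real.goldenConj * ((j + m : ℕ) : ℝ)⌋ - ⌊-Real.goldenConj * j⌋)) :
    ∃ p : ℤ, Even p ∧ |-Real.goldenConj * m - p| < (-Real.goldenConj) ^ k := by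
  set b := -Real.goldenConj
  have hl := Int.floor_le (b * m)
  have hu := Int.lt_floor_add_one (b * m)
  set P := ⌊b * m⌋
  rcases Int.even_or_odd P with hP | hP
  · refine ⟨P, hP, ?_⟩
    rw [abs_of_nonneg (by linarith)]
    by_contra! hc
    -- In this arc the fractional parts of `bj` and `bm` carry, giving the odd jump `P + 1`.
    obtain ⟨j, q, h1, h2, h3, h4⟩ := exists_neg_goldenConj_mul_sub_mem_arc k s (1 - (b * m - P))
    have f1 : ⌊b * j⌋ = q := by
      rw [Int.floor_eq_iff]; constructor <;> linarith
    have f2 : ⌊b * ((j + m : ℕ) : ℝ)⌋ = q + P + 1 := by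
      rw [Int.floor_eq_iff]; push_cast; constructor <;> linarith
    have := h j h1 (by omega)
    rw [f1, f2] at this
    rw [Int.even_iff] at *
    omega
  · refine ⟨P + 1, hP.add_one, ?_⟩
    push_cast
    rw [abs_sub_comm, abs_of_nonneg (by linarith)]
    by_contra! hc
    -- Here there is no carry, and the jump is the odd `P`.
    obtain ⟨j, q, h1, h2, h3, h4⟩ := exists_neg_goldenConj_mul_sub_mem_arc k s 0
    have f1 : ⌊b * j⌋ = q := by
      rw [Int.floor_eq_iff]; constructor <;> linarith
    have f2 : ⌊b * ((j + m : ℕ) : ℝ)⌋ = q + P := by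
      rw [Int.floor_eq_iff]; push_cast; constructor <;> linarith
    have := h j h1 (by omega)
    rw [f1, f2] at this
    rw [Int.even_iff] at this
    rw [Int.odd_iff] at hP
    omega

/-- In Fibonacci coordinates the hypothesis reads `|xψ + y| < 1/b = 1 + b`. Nonzero `x`, `y` of
opposite signs violate it, and the range of `m` leaves only `(x, y) = (1, 0)`. -/
theorem eq_fib_of_abs_lt {k : ℕ} (hk : 1 ≤ k) {m p : ℤ} (hm : Nat.fib (k + 2) ≤ m)
    (hm' : m < Nat.fib (k + 3))
    (h : |-Real.goldenConj * m - p| < (-Real.goldenConj) ^ k) :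
    m = Nat.fib (k + 2) ∧ p = Nat.fib (k + 1) := by
  obtain ⟨x, y, hx, hy⟩ := exists_fib_coordinates k m p
  have hψ := Real.goldenConj_neg
  have hb := one_add_neg_goldenConj_mul
  have hψ1 := Real.neg_one_lt_goldenConj
  rw [show -Real.goldenConj * m - p = -(Real.goldenConj * m + p) by ring, abs_neg,
    goldenConj_mul_add_of_fib_coordinates hx hy, abs_mul, abs_goldenConj_pow, pow_succ,
    mul_assoc] at h
  have hpos : 0 < (-Real.goldenConj) ^ k := pow_pos (by linarith) _
  have h' : |(x : ℝ) * Real.goldenConj + y| < 1 + -Real.goldenConj := by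
    have : -Real.goldenConj * |(x : ℝ) * Real.goldenConj + y| < 1 := by
      by_contra! hc
      nlinarith
    by_contra! hc
    nlinarith
  rw [abs_lt] at h'
  have hF : Nat.fib (k + 3) = Nat.fib (k + 1) + Nat.fib (k + 2) := Nat.fib_add_two
  have hF12 : Nat.fib (k + 1) < Nat.fib (k + 2) := Nat.fib_lt_fib_succ (by omega)
  have hF1 : 0 < Nat.fib (k + 1) := Nat.fib_pos.2 (by omega)
  rw [hF] at hm'
  zify at hF12 hF1
  push_cast at hm'
  have hy0 : y = 0 := by
    rcases lt_trichotomy y 0 with hy0 | hy0 | hy0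
    · exfalso
      have hx0 : 1 ≤ x := by
        by_contra! hc
        nlinarith
      have h1 : (y : ℝ) ≤ -1 := by exact_mod_cast (by omega : y ≤ -1)
      have h2 : (1 : ℝ) ≤ x := by exact_mod_cast hx0
      nlinarith
    · exact hy0
    · exfalso
      have hx0 : x ≤ 0 := by
        by_contra! hc
        nlinarith
      have h1 : (1 : ℝ) ≤ y := by exact_mod_cast hy0
      rcases hx0.eq_or_lt with rfl | hx0
      · have h2 : (y : ℝ) < 2 := by push_cast at h'; linarith
        have h3 : y < 2 := by exact_mod_cast h2
        obtain rfl : y = 1 := by omega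
        linarith
      · have h2 : (x : ℝ) ≤ -1 := by exact_mod_cast (by omega : x ≤ -1)
        nlinarith
  subst hy0
  have hx1 : x = 1 := by
    have : x < 2 := by
      by_contra! hc
      nlinarith
    have : 0 < x := by
      by_contra! hc
      nlinarith
    omega
  subst hx1
  simp_all

theorem eq_fib_of_roteFibonacci_periodic {i m : ℕ} (hm : 0 < m)
    (h : ∀ j < m, roteFibonacci (i + j) = roteFibonacci (i + (m + j))) :
    ∃ n, m = Nat.fib (3 * n + 1) := by
  rcases Nat.eq_or_lt_of_le (Nat.succ_le_of_lt hm) with rfl | hm2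
  · exact ⟨0, rfl⟩
  have h3 : 3 ≤ Nat.greatestFib m := Nat.le_greatestFib.2 hm2
  obtain ⟨k, hk⟩ := Nat.exists_eq_add_of_le h3
  have h1 := Nat.fib_greatestFib_le m
  have h2 := Nat.lt_fib_greatestFib_add_one m
  rw [hk, show 3 + k = k + 1 + 2 by omega] at h1 h2
  -- The window starts at `i + 2` because the coding shifts indices by 2.
  obtain ⟨p, hp, hlt⟩ := exists_even_abs_lt (s := i + 2) h1 fun j hj hj' => by
    obtain ⟨t, rfl⟩ := Nat.exists_eq_add_of_le hj
    have e := roteFibonacci_eq_zero_iff (i + t)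
    rw [h t (by omega), roteFibonacci_eq_zero_iff, ← Int.not_even_iff_odd, ← Int.not_even_iff_odd,
      not_iff_not] at e
    rw [Int.even_sub, show i + 2 + t + m = i + (m + t) + 2 by omega,
      show i + 2 + t = i + t + 2 by omega]
    exact e
  obtain ⟨e1, e2⟩ := eq_fib_of_abs_lt (k := k + 1) (m := m) (by omega) (by exact_mod_cast h1)
    (by exact_mod_cast h2) (by exact_mod_cast hlt)
  rw [e2, Int.even_coe_nat, even_fib_iff] at hp
  refine ⟨(k + 2) / 3, ?_⟩
  rw [show 3 * ((k + 2) / 3) + 1 = k + 1 + 2 by omega]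
  exact_mod_cast e1

theorem mainTheorem6 :
    (∀ (w : List (Fin 2)) (m : ℕ), IsSquareOfOrder w m → OccursIn w roteFibonacci →
      ∃ n : ℕ, m = Nat.fib (3 * n + 1)) ∧
    (∀ n : ℕ, ∃ w : List (Fin 2),
      IsSquareOfOrder w (Nat.fib (3 * n + 1)) ∧ OccursIn w roteFibonacci) := by
  constructor
  · rintro w m ⟨hw, x, rfl, rfl⟩ ⟨i, hi⟩
    have hx : 0 < x.length := by
      rw [List.length_pos_iff]
      rintro rfl
      exact hw rfl
    refine eq_fib_of_roteFibonacci_periodic (i := i) hx fun j hj => ?_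
    rw [← hi j (by simp; omega), ← hi (x.length + j) (by simp; omega),
      List.getElem_append_left hj, List.getElem_append_right (by omega)]
    simp
  · rintro (_ | n)
    · exact ⟨[0, 0], ⟨by simp, [0], rfl, rfl⟩, 0, by decide⟩
    · have hpos : 0 < Nat.fib (3 * n + 4) := Nat.fib_pos.2 (by omega)
      have hper := roteFibonacci_fib_add_of_lt n
      rw [show 3 * (n + 1) + 1 = 3 * n + 4 by omega]
      generalize Nat.fib (3 * n + 4) = m at hpos hper
      set x := List.ofFn fun t : Fin m => roteFibonacci t with hxdef
      have hlen : x.length = m := by simp [hxdef]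
      have hget : ∀ (t : ℕ) (ht : t < x.length), x[t] = roteFibonacci t := by simp [hxdef]
      refine ⟨x ++ x, ⟨?_, x, rfl, hlen⟩, 0, fun j hj => ?_⟩
      · rw [← List.length_pos_iff, List.length_append]
        omega
      · rw [List.length_append] at hj
        rw [Nat.zero_add]
        rcases lt_or_ge j x.length with h | h
        · rw [List.getElem_append_left h, hget]
        · rw [List.getElem_append_right h, hget, ← hper _ (by omega)]
          congr 1
          omega
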